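/- Let $G$ be a unimodular Lie group (finite-dimensional, Hausdorff, second countable) with Haar measure $\mu_G$ (any normalization). Let $\mathcal{A}$ be a unital $C^*$-algebra, $\rho_0$ a state on $\mathcal{A}$ with GNS representation $(\pi_{\rho_0},\mathcal{H}_{\rho_0})$, and $U\colon G\to\mathcal{A}$ a unitary representation of $G$ by unitary elements of $\mathcal{A}$, such that the induced unitary representation $U_0(g)=\pi_{\rho_0}(U(g))$ on $\mathcal{H}_{\rho_0}$ is strongly continuous. Inner products are antilinear in the first variable. Assume that $U_0$ is square integrable with respect to $\mu_G$, i.e. it is irreducible and $\int_G|\langle\phi,U_0(g)\psi\rangle|^2\,\mathrm{d}\mu_G(g)<\infty$ for some nonzero vectors $\phi,\psi\in\mathcal{H}_{\rho_0}$. Then $U_0$ has a well-defined formal degree: there is exactly one real number $d>0$ such that all coefficients $g\mapsto\langle\phi,U_0(g)\psi\rangle$ are in $L^2(G,\mu_G)$ and $$\int_G\langle\phi_1,U_0(g)\psi_1\rangle\,\langle U_0(g)\psi_2,\phi_2\rangle\,\mathrm{d}\mu_G(g)=d^{-1}\langle\phi_1,\phi_2\rangle\langle\psi_2,\psi_1\rangle\qquad\text{for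 all }\phi_1,\phi_2,\psi_1,\psi_2\in\mathcal{H}_{\rho_0}.$$ With this $d$, for every trace-class operator $\mathbf{A}$ on $\mathcal{H}_{\rho_0}$, the trace $\mathrm{Tr}(\mathbf{A})=\sum_i\langle e_i,\mathbf{A}e_i\rangle$ converges unconditionally to the same value in every orthonormal basis $(e_i)$, the integral of $g\mapsto U_0(g)\mathbf{A}U_0(g)^\dagger$ over $G$ exists as a bounded operator in the weak operator sense (that is, for all $\phi,\psi$ the function $g\mapsto\langle\phi,U_0(g)\mathbf{A}U_0(g)^\dagger\psi\rangle$ is integrable, and its integral is the corresponding matrix element of that operator), and $$\mathrm{Tr}(\mathbf{A})\,\mathbb{1}=d\int_G U_0(g)\,\mathbf{A}\,U_0(g)^\dagger\,\mathrm{d}\mu_G(g).$$ -/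

import Mathlib

open MeasureTheory
open scoped InnerProductSpace ContDiff Manifold ComplexOrder

noncomputable section

section Operators

variable {H : Type*} [NormedAddCommGroup H] [InnerProductSpace ℂ H] [CompleteSpace H]

/-- `A` is a trace-class operator: `∑ᵢ ⟨eᵢ, |A| eᵢ⟩ < ∞` for some (equivalently, every) orthonormal
basis `e`, where `|A| = (A†A)^{1/2}`. -/
def IsTraceClass (A : H →L[ℂ] H) : Prop :=
  ∃ (w : Set H) (e : HilbertBasis w ℂ H),
    Summable fun i : w => (⟪e i, CFC.abs A (e i)⟫_ℂ).re

/-- An index set for some orthonormal basis of `H`. -/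
def basisIndex (H : Type*) [NormedAddCommGroup H] [InnerProductSpace ℂ H] [CompleteSpace H] :
    Set H :=
  (exists_hilbertBasis ℂ H).choose

/-- Some orthonormal basis of `H`. -/
def someBasis (H : Type*) [NormedAddCommGroup H] [InnerProductSpace ℂ H] [CompleteSpace H] :
    HilbertBasis (basisIndex H) ℂ H :=
  (exists_hilbertBasis ℂ H).choose_spec.choose

/-- The trace `∑ᵢ ⟨eᵢ, A eᵢ⟩` of an operator, computed in some orthonormal basis. -/
def opTrace (A : H →L[ℂ] H) : ℂ :=
  ∑' i, ⟪someBasis H i, A (someBasis H i)⟫_ℂ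

/-- `C = ∫ F(x) dμ(x)` in the weak operator sense: for all vectors `φ, ψ`, the function
`x ↦ ⟨φ, F(x) ψ⟩` is integrable, with integral `⟨φ, C ψ⟩`. -/
def HasWeakIntegral {X : Type*} [MeasurableSpace X] (μ : Measure X) (F : X → H →L[ℂ] H)
    (C : H →L[ℂ] H) : Prop :=
  ∀ φ ψ : H, Integrable (fun x => ⟪φ, F x ψ⟫_ℂ) μ ∧ ∫ x, ⟪φ, F x ψ⟫_ℂ ∂μ = ⟪φ, C ψ⟫_ℂ

end Operators

section Representations

variable {G : Type*} [Group G]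
variable {H : Type*} [NormedAddCommGroup H] [InnerProductSpace ℂ H] [CompleteSpace H]

/-- The unitary operator `π(g)`, as a bounded operator. -/
abbrev repOp (π : G →* unitary (H →L[ℂ] H)) (g : G) : H →L[ℂ] H := (π g : H →L[ℂ] H)

/-- Strong continuity: all the orbit maps `g ↦ π(g) v` are continuous. -/
def IsStronglyContinuousRep [TopologicalSpace G] (π : G →* unitary (H →L[ℂ] H)) : Prop :=
  ∀ v : H, Continuous fun g => repOp π g v

/-- Topological irreducibility: `H ≠ 0`, and the only closed invariant subspaces are `0` and `H`. -/
def IsIrreducibleRep (π : G →* unitary (H →L[ℂ] H)) : Prop :=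
  Nontrivial H ∧
    ∀ K : Submodule ℂ H, IsClosed (K : Set H) → (∀ g, ∀ v ∈ K, repOp π g v ∈ K) → K = ⊥ ∨ K = ⊤

/-- `π` is square integrable: it is irreducible, and for some nonzero vectors `φ, ψ` the coefficient
`g ↦ ⟨φ, π(g) ψ⟩` is in `L²(G, μ)`. -/
def IsSquareIntegrableRep [MeasurableSpace G] (μ : Measure G)
    (π : G →* unitary (H →L[ℂ] H)) : Prop :=
  IsIrreducibleRep π ∧
    ∃ φ ψ : H, φ ≠ 0 ∧ ψ ≠ 0 ∧ MemLp (fun g => ⟪φ, repOp π g ψ⟫_ℂ) 2 μ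

/-- `d` is the formal degree of `π`: `0 < d < ∞`, all coefficients of `π` are in `L²(G, μ)`, and
`∫ ⟨φ₁, π(g) ψ₁⟩ ⟨π(g) ψ₂, φ₂⟩ dμ(g) = d⁻¹ ⟨φ₁, φ₂⟩ ⟨ψ₂, ψ₁⟩` for all vectors. -/
def IsFormalDegree [MeasurableSpace G] (μ : Measure G) (π : G →* unitary (H →L[ℂ] H))
    (d : ℝ) : Prop :=
  0 < d ∧
    (∀ φ ψ : H, MemLp (fun g => ⟪φ, repOp π g ψ⟫_ℂ) 2 μ) ∧
    ∀ φ₁ ψ₁ φ₂ ψ₂ : H,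
      ∫ g, ⟪φ₁, repOp π g ψ₁⟫_ℂ * ⟪repOp π g ψ₂, φ₂⟫_ℂ ∂μ =
        (d : ℂ)⁻¹ * (⟪φ₁, φ₂⟫_ℂ * ⟪ψ₂, ψ₁⟫_ℂ)

/-- The unitary representation `U₀ = π_ρ ∘ U` on the GNS Hilbert space of the positive functional
`ρ`, for a unitary representation `U` of `G` in the unital C⋆-algebra `𝒜`. -/
def gnsRep {𝒜 : Type*} [CStarAlgebra 𝒜] [PartialOrder 𝒜] [StarOrderedRing 𝒜]
    (ρ : 𝒜 →ₚ[ℂ] ℂ) (U : G →* unitary 𝒜) : G →* unitary (ρ.GNS →L[ℂ] ρ.GNS) where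
  toFun g := ⟨ρ.gnsStarAlgHom (U g : 𝒜), by
    rw [Unitary.mem_iff, ← map_star, ← map_mul, ← map_mul,
      Unitary.star_mul_self_of_mem (U g).2, Unitary.mul_star_self_of_mem (U g).2, map_one]
    exact ⟨rfl, rfl⟩⟩
  map_one' := Subtype.ext (by simp only [map_one, OneMemClass.coe_one])
  map_mul' g h := Subtype.ext (by simp only [map_mul, Submonoid.coe_mul])

end Representations

end

/-! For a fixed orbit `u(g) = π(g)ψ`, the coefficient map `C : v ↦ ⟨u(·), v⟩` into `L²` is closed on
an invariant domain, dense by irreducibility. Projecting `(v, 0)` onto its graph gives a bounded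
self-adjoint `S = (1 + C†C)⁻¹`. Translation invariance of the measure makes `S` commute with `π`, so
Schur's lemma gives `S = c`; hence `C` is everywhere defined and its Gram form is `(c⁻¹ - 1)⟨v, w⟩`
(`IsIrreducibleRep.l2Form_eq`). Left translations treat the variable `φ`, right translations the
variable `ψ`; comparing the two constants yields the orthogonality relations, and `d⁻¹ = ∫ |⟨e,
π(g)e⟩|²` for a unit vector `e`. For the trace formula, write `A = Y T` with `Y`, `T`
Hilbert-Schmidt and `T = |A|^{1/2}`. Expanding `⟨φ, π(g) Y T π(g)† ψ⟩` in a basis gives terms `⟨φ,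
π(g) Y eᵢ⟩⟨π(g) T eᵢ, ψ⟩`, each integrating to `d⁻¹⟨φ, ψ⟩⟨T eᵢ, Y eᵢ⟩`; Hilbert-Schmidt bounds allow
termwise integration, and `∑ ⟨T eᵢ, Y eᵢ⟩ = Tr A`. -/

noncomputable section

/-! ### Schur's lemma -/

section Schur

variable {G : Type*} [Group G]
variable {H : Type*} [NormedAddCommGroup H] [InnerProductSpace ℂ H] [CompleteSpace H]

/-- If `P * Q = 0` and `P` commutes with an irreducible representation, then `P` or `Q` vanishes. -/
theorem IsIrreducibleRep.eq_zero_or_eq_zero_of_mul_eq_zero {π : G →* unitary (H →L[ℂ] H)}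
    (hπ : IsIrreducibleRep π) {P Q : H →L[ℂ] H} (hP : ∀ g, Commute P (repOp π g)) (hPQ : P * Q = 0) :
    P = 0 ∨ Q = 0 := by
  rcases hπ.2 P.ker P.isClosed_ker (fun g v hv => by
    have h1 : P v = 0 := hv
    have h2 : P (repOp π g v) = repOp π g (P v) := congr($((hP g).eq) v)
    change P (repOp π g v) = 0
    rw [h2, h1, map_zero]) with h | h
  · right
    ext v
    have : Q v ∈ P.ker := congr($hPQ v)
    rw [h] at this
    simpa using this
  · left
    ext v
    have : v ∈ P.ker := h ▸ Submodule.mem_top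
    exact this

/-- Schur's lemma for self-adjoint operators. -/
theorem IsIrreducibleRep.exists_eq_smul_one {π : G →* unitary (H →L[ℂ] H)}
    (hπ : IsIrreducibleRep π) {S : H →L[ℂ] H} (hS : IsSelfAdjoint S)
    (hcomm : ∀ g, Commute S (repOp π g)) : ∃ c : ℝ, S = (c : ℂ) • (1 : H →L[ℂ] H) := by
  have := hπ.1
  have hsub : (spectrum ℝ S).Subsingleton := by
    intro a ha b hb
    by_contra hab
    wlog hlt : a < b generalizing a b
    · exact this hb ha (Ne.symm hab) (lt_of_le_of_ne (not_lt.mp hlt) (Ne.symm hab))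
    -- Bump functions on either side of the midpoint have product zero, yet neither vanishes on the
    -- spectrum.
    set m := (a + b) / 2
    have hf : Continuous fun x : ℝ => max (m - x) 0 := by fun_prop
    have hg : Continuous fun x : ℝ => max (x - m) 0 := by fun_prop
    have hprod : cfc (fun x : ℝ => max (m - x) 0) S * cfc (fun x : ℝ => max (x - m) 0) S = 0 := by
      rw [← cfc_mul _ _ S hf.continuousOn hg.continuousOn]
      have : (fun x : ℝ => max (m - x) 0 * max (x - m) 0) = fun _ => 0 := by
        ext x
        rcases le_total x m with h | h
        · rw [max_eq_right (sub_nonpos.mpr h), mul_zero]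
        · rw [max_eq_right (sub_nonpos.mpr h), zero_mul]
      rw [this]
      exact cfc_const_zero ℝ S
    have key : ∀ f : ℝ → ℝ, Continuous f → ∀ x ∈ spectrum ℝ S, cfc f S = 0 → f x = 0 := by
      intro f hf x hx h0
      have h1 := cfc_map_spectrum (R := ℝ) f S (hf := hf.continuousOn)
      rw [h0, spectrum.zero_eq] at h1
      have : f x ∈ f '' spectrum ℝ S := ⟨x, hx, rfl⟩
      rw [← h1] at this
      exact this
    rcases hπ.eq_zero_or_eq_zero_of_mul_eq_zero (fun g => (hcomm g).cfc_real _) hprod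
      with h | h
    · have := key _ hf a ha h
      have h2 := le_max_left (m - a) 0
      simp only [m] at *
      linarith
    · have := key _ hg b hb h
      have h2 := le_max_left (b - m) 0
      simp only [m] at *
      linarith
  obtain ⟨c, hc⟩ : (spectrum ℝ S).Nonempty :=
    ContinuousFunctionalCalculus.spectrum_nonempty S hS
  refine ⟨c, ?_⟩
  have h1 : cfc (id : ℝ → ℝ) S = cfc (fun _ => c) S := cfc_congr fun x hx => hsub hx hc
  rw [cfc_id ℝ S, cfc_const c S] at h1
  rw [h1, Algebra.algebraMap_eq_smul_one]
  ext v
  simp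

end Schur

/-! ### The closed coefficient operator and its Gram form -/

section Coefficients

variable {H : Type*} [NormedAddCommGroup H] [InnerProductSpace ℂ H]
variable {X : Type*} [MeasurableSpace X] {μ : Measure X}

/-- The vectors `v` for which `x ↦ ⟨u(x), v⟩` is square integrable. -/
def l2Domain (μ : Measure X) (u : X → H) : Submodule ℂ H where
  carrier := {v | MemLp (fun x => ⟪u x, v⟫_ℂ) 2 μ}
  zero_mem' := by simp
  add_mem' {v w} hv hw := by
    simpa only [Set.mem_ofPred_eq, inner_add_right] using! MemLp.add hv hw
  smul_mem' c v hv := by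
    simpa only [Set.mem_ofPred_eq, inner_smul_right] using! MemLp.const_mul hv c

theorem mem_l2Domain {u : X → H} {v : H} :
    v ∈ l2Domain μ u ↔ MemLp (fun x => ⟪u x, v⟫_ℂ) 2 μ := Iff.rfl

/-- The graph of `v ↦ ⟨u(·), v⟩`, as a map from `H` to `L²`. -/
def l2Graph (μ : Measure X) (u : X → H) : Submodule ℂ (WithLp 2 (H × Lp ℂ 2 μ)) where
  carrier := {p | p.snd =ᵐ[μ] fun x => ⟪u x, p.fst⟫_ℂ}
  zero_mem' := by
    filter_upwards [Lp.coeFn_zero ℂ 2 μ] with x hx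
    simpa using hx
  add_mem' {p q} hp hq := by
    filter_upwards [hp, hq, Lp.coeFn_add p.snd q.snd] with x h1 h2 h3
    rw [WithLp.add_snd, h3, WithLp.add_fst, inner_add_right, Pi.add_apply, h1, h2]
  smul_mem' c p hp := by
    filter_upwards [hp, Lp.coeFn_smul c p.snd] with x h1 h3
    rw [WithLp.smul_snd, h3, WithLp.smul_fst, inner_smul_right, Pi.smul_apply, h1, smul_eq_mul]

/-- An `L²` limit is an a.e. limit along a subsequence, while the coefficients converge pointwise.
-/
theorem isClosed_l2Graph (u : X → H) : IsClosed (l2Graph μ u : Set (WithLp 2 (H × Lp ℂ 2 μ))) := by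
  refine IsSeqClosed.isClosed fun p q hp hpq => ?_
  have hfst : Filter.Tendsto (fun n => (p n).fst) Filter.atTop (nhds q.fst) :=
    (WithLp.prod_continuous_ofLp 2 H (Lp ℂ 2 μ)).fst.tendsto q |>.comp hpq
  have hsnd : Filter.Tendsto (fun n => (p n).snd) Filter.atTop (nhds q.snd) :=
    (WithLp.prod_continuous_ofLp 2 H (Lp ℂ 2 μ)).snd.tendsto q |>.comp hpq
  obtain ⟨ns, hns, hlim⟩ := (tendstoInMeasure_of_tendsto_Lp hsnd).exists_seq_tendsto_ae
  have hp' : ∀ᵐ x ∂μ, ∀ n, (p n).snd x = ⟪u x, (p n).fst⟫_ℂ := ae_all_iff.mpr hp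
  filter_upwards [hlim, hp'] with x hx hx'
  refine tendsto_nhds_unique hx ?_
  simp only [hx']
  exact (tendsto_const_nhds.inner hfst).comp hns.tendsto_atTop

theorem fst_mem_l2Domain {u : X → H} {p : WithLp 2 (H × Lp ℂ 2 μ)} (hp : p ∈ l2Graph μ u) :
    p.fst ∈ l2Domain μ u :=
  (Lp.memLp p.snd).ae_eq hp

theorem toLp_mem_l2Graph {u : X → H} {v : H} (hv : v ∈ l2Domain μ u) :
    WithLp.toLp 2 (v, MemLp.toLp _ (mem_l2Domain.mp hv)) ∈ l2Graph μ u :=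
  MemLp.coeFn_toLp hv

/-- The Gram form of the coefficients. -/
def l2Form (μ : Measure X) (u : X → H) (v w : H) : ℂ := ∫ x, ⟪v, u x⟫_ℂ * ⟪u x, w⟫_ℂ ∂μ

theorem inner_of_mem_l2Graph {u : X → H} {p q : WithLp 2 (H × Lp ℂ 2 μ)}
    (hp : p ∈ l2Graph μ u) (hq : q ∈ l2Graph μ u) :
    ⟪p, q⟫_ℂ = ⟪p.fst, q.fst⟫_ℂ + l2Form μ u p.fst q.fst := by
  rw [WithLp.prod_inner_apply]
  congr 1
  change ⟪p.snd, q.snd⟫_ℂ = _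
  rw [L2.inner_def]
  refine integral_congr_ae ?_
  filter_upwards [hp, hq] with x h1 h2
  rw [h1, h2, RCLike.inner_apply, inner_conj_symm, mul_comm]

variable [CompleteSpace H]

/-- The functionals `⟨·, v⟩` are represented in the form `⟨w, v⟩ + l2Form w v` by a bounded
self-adjoint operator. -/
theorem exists_isSelfAdjoint_inner_add_l2Form (u : X → H) :
    ∃ S : H →L[ℂ] H, IsSelfAdjoint S ∧ (∀ v, S v ∈ l2Domain μ u) ∧
      ∀ w ∈ l2Domain μ u, ∀ v, ⟪w, S v⟫_ℂ + l2Form μ u w (S v) = ⟪w, v⟫_ℂ := by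
  have : CompleteSpace (l2Graph μ u) := (isClosed_l2Graph u).completeSpace_coe
  -- `S` is the compression of the graph projection to the first factor, hence self-adjoint.
  let P := (l2Graph μ u).starProjection
  let S : H →L[ℂ] H := WithLp.fstL 2 ℂ H (Lp ℂ 2 μ) ∘L P ∘L
    (WithLp.prodContinuousLinearEquiv 2 ℂ H (Lp ℂ 2 μ)).symm.toContinuousLinearMap ∘L
      ContinuousLinearMap.inl ℂ H (Lp ℂ 2 μ)
  have hSv : ∀ v, S v = (P (WithLp.toLp 2 (v, 0))).fst := fun v => rfl
  have hinner : ∀ (p : WithLp 2 (H × Lp ℂ 2 μ)) (v : H), ⟪p, WithLp.toLp 2 (v, 0)⟫_ℂ = ⟪p.fst, v⟫_ℂ := by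
    intro p v
    rw [WithLp.prod_inner_apply]
    simp
  refine ⟨S, ?_, fun v => ?_, fun w hw v => ?_⟩
  · rw [ContinuousLinearMap.isSelfAdjoint_iff_isSymmetric]
    intro v w
    change ⟪S v, w⟫_ℂ = ⟪v, S w⟫_ℂ
    rw [hSv, hSv, ← hinner, Submodule.inner_starProjection_left_eq_right, ← inner_conj_symm,
      hinner, inner_conj_symm]
  · exact fst_mem_l2Domain ((l2Graph μ u).starProjection_apply_mem _)
  · have h1 := inner_of_mem_l2Graph (toLp_mem_l2Graph hw)
      ((l2Graph μ u).starProjection_apply_mem (WithLp.toLp 2 (v, 0)))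
    rw [← Submodule.inner_starProjection_left_eq_right,
      Submodule.starProjection_eq_self_iff.mpr (toLp_mem_l2Graph hw), hinner] at h1
    exact h1.symm

/-- Square integrability of one coefficient of an irreducible representation gives square
integrability of all of them, and the Gram form is a multiple of the inner product. -/
theorem IsIrreducibleRep.l2Form_eq {G : Type*} [Group G] {π : G →* unitary (H →L[ℂ] H)} (hπ : IsIrreducibleRep π)
    {u : X → H}
    (hu : ∀ h, ∃ τ : X → X, MeasurePreserving τ μ μ ∧
      ∀ x v, ⟪u x, repOp π h v⟫_ℂ = ⟪u (τ x), v⟫_ℂ)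
    (hmeas : ∀ v, StronglyMeasurable fun x => ⟪u x, v⟫_ℂ)
    {v₀ : H} (hv₀ : v₀ ≠ 0) (hmem : v₀ ∈ l2Domain μ u) :
    (∀ v, v ∈ l2Domain μ u) ∧ ∃ c : ℂ, ∀ v w, l2Form μ u v w = c * ⟪v, w⟫_ℂ := by
  have hinv : ∀ h, ∀ v ∈ l2Domain μ u, repOp π h v ∈ l2Domain μ u := by
    intro h v hv
    obtain ⟨τ, hτ, hτu⟩ := hu h
    rw [mem_l2Domain]
    simp only [hτu]
    exact (mem_l2Domain.mp hv).comp_measurePreserving hτ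
  have hform : ∀ h v w, l2Form μ u (repOp π h v) (repOp π h w) = l2Form μ u v w := by
    intro h v w
    obtain ⟨τ, hτ, hτu⟩ := hu h
    have hτu' : ∀ x v, ⟪repOp π h v, u x⟫_ℂ = ⟪v, u (τ x)⟫_ℂ := fun x v => by
      rw [← inner_conj_symm, hτu, inner_conj_symm]
    simp only [l2Form, hτu, hτu']
    have hm : StronglyMeasurable fun x => ⟪v, u x⟫_ℂ * ⟪u x, w⟫_ℂ := by
      simp_rw [← inner_conj_symm v]
      exact (Complex.continuous_conj.comp_stronglyMeasurable (hmeas v)).mul (hmeas w)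
    conv_rhs => rw [← hτ.map_eq]
    rw [integral_map hτ.aemeasurable hm.aestronglyMeasurable]
  have hunit : ∀ h v w, ⟪repOp π h v, repOp π h w⟫_ℂ = ⟪v, w⟫_ℂ := fun h v w =>
    ContinuousLinearMap.inner_map_map_of_mem_unitary (π h).2 v w
  have hright : ∀ h v, repOp π h (repOp π h⁻¹ v) = v := fun h v => by
    have : repOp π h * repOp π h⁻¹ = 1 := by
      rw [repOp, repOp, ← Submonoid.coe_mul, ← map_mul, mul_inv_cancel, map_one,
        OneMemClass.coe_one]
    exact congr($this v)
  have hdense : ∀ v : H, (∀ w ∈ l2Domain μ u, ⟪w, v⟫_ℂ = 0) → v = 0 := by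
    intro v hv
    have htop : (l2Domain μ u).topologicalClosure = ⊤ := by
      refine (hπ.2 _ (Submodule.isClosed_topologicalClosure _) fun g w hw => ?_).resolve_left ?_
      · exact map_mem_closure (repOp π g).continuous hw (hinv g)
      · intro hbot
        have := (l2Domain μ u).le_topologicalClosure hmem
        rw [hbot] at this
        exact hv₀ (by simpa using this)
    have h1 : v ∈ (l2Domain μ u)ᗮ := (Submodule.mem_orthogonal _ _).mpr hv
    rw [← Submodule.orthogonal_closure, htop, Submodule.top_orthogonal_eq_bot] at h1
    simpa using h1
  obtain ⟨S, hS, hSmem, hSform⟩ := exists_isSelfAdjoint_inner_add_l2Form (μ := μ) u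
  have hadd : ∀ w ∈ l2Domain μ u, ∀ a ∈ l2Domain μ u, ∀ b ∈ l2Domain μ u,
      l2Form μ u w (a - b) = l2Form μ u w a - l2Form μ u w b := by
    intro w hw a ha b hb
    simp only [l2Form, inner_sub_right, mul_sub]
    have hint : ∀ a ∈ l2Domain μ u, Integrable (fun x => ⟪w, u x⟫_ℂ * ⟪u x, a⟫_ℂ) μ := by
      intro a ha
      refine MemLp.integrable_mul (p := 2) (q := 2) ?_ ha
      simp_rw [← inner_conj_symm w]
      exact (mem_l2Domain.mp hw).star
    exact integral_sub (hint a ha) (hint b hb)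
  have hcomm : ∀ h, Commute S (repOp π h) := by
    intro h
    ext v
    change S (repOp π h v) = repOp π h (S v)
    rw [← sub_eq_zero]
    have ha := hSmem (repOp π h v)
    have hb := hinv h _ (hSmem v)
    set a := S (repOp π h v)
    set b := repOp π h (S v)
    have hw := (l2Domain μ u).sub_mem ha hb
    -- By invariance `a` and `b` solve the same variational equation; testing with `w = a - b`
    -- forces `a = b`, as the form is nonnegative.
    have key : ∀ w ∈ l2Domain μ u, ⟪w, a - b⟫_ℂ + l2Form μ u w (a - b) = 0 := by
      intro w hw
      have h1 := hSform w hw (repOp π h v)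
      have h2 := hSform (repOp π h⁻¹ w) (hinv _ _ hw) v
      rw [← hunit h, ← hform h, ← hunit h _ v, hright] at h2
      rw [hadd w hw a ha b hb, inner_sub_right]
      linear_combination h1 - h2
    have h3 := congr(Complex.re $(key _ hw))
    rw [Complex.add_re, Complex.zero_re] at h3
    have h4 : 0 ≤ (l2Form μ u (a - b) (a - b)).re := by
      have : l2Form μ u (a - b) (a - b) = ((∫ x, ‖⟪u x, a - b⟫_ℂ‖ ^ 2 ∂μ : ℝ) : ℂ) := by
        rw [l2Form, ← integral_complex_ofReal]
        refine integral_congr_ae (.of_forall fun x => ?_)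
        change ⟪a - b, u x⟫_ℂ * ⟪u x, a - b⟫_ℂ = _
        rw [← inner_conj_symm, Complex.conj_mul']
        norm_cast
      rw [this, Complex.ofReal_re]
      positivity
    have h5 : (⟪a - b, a - b⟫_ℂ).re = ‖a - b‖ ^ 2 := inner_self_eq_norm_sq (𝕜 := ℂ) _
    rw [← norm_eq_zero, ← sq_eq_zero_iff]
    nlinarith [sq_nonneg ‖a - b‖]
  obtain ⟨c, rfl⟩ := hπ.exists_eq_smul_one hS hcomm
  -- If `S = 0`, then `v₀` would be orthogonal to the dense domain.
  have hc : (c : ℂ) ≠ 0 := by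
    intro h0
    refine hv₀ (hdense v₀ fun w hw => ?_)
    rw [← hSform w hw v₀, h0]
    simp [l2Form]
  have hall : ∀ v, v ∈ l2Domain μ u := fun v => by
    have := (l2Domain μ u).smul_mem (c : ℂ)⁻¹ (hSmem v)
    rwa [smul_apply, one_apply_eq_self, inv_smul_smul₀ hc] at this
  refine ⟨hall, (c : ℂ)⁻¹ - 1, fun v w => ?_⟩
  have h1 := hSform v (hall v) ((c : ℂ)⁻¹ • w)
  have h2 : ((c : ℂ) • (1 : H →L[ℂ] H)) ((c : ℂ)⁻¹ • w) = w := by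
    rw [smul_apply, one_apply_eq_self, smul_inv_smul₀ hc]
  rw [h2, inner_smul_right] at h1
  linear_combination h1

end Coefficients

/-! ### Polarization of integrated coefficients -/

section Polarization

variable {H : Type*} [NormedAddCommGroup H] [InnerProductSpace ℂ H]

theorem integrable_inner_mul_inner {X : Type*} [MeasurableSpace X] {μ : Measure X} {a b : X → H}
    {v w : H} (ha : MemLp (fun x => ⟪v, a x⟫_ℂ) 2 μ) (hb : MemLp (fun x => ⟪w, b x⟫_ℂ) 2 μ) :
    Integrable (fun x => ⟪v, a x⟫_ℂ * ⟪b x, w⟫_ℂ) μ := by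
  refine MemLp.integrable_mul (p := 2) (q := 2) ha ?_
  simp_rw [← inner_conj_symm _ w]
  exact hb.star

theorem integral_inner_mul_inner_eq_of_diag {X : Type*} [MeasurableSpace X] {μ : Measure X}
    {a b : X → H} (ha : ∀ v, MemLp (fun x => ⟪v, a x⟫_ℂ) 2 μ)
    (hb : ∀ v, MemLp (fun x => ⟪v, b x⟫_ℂ) 2 μ) {k : ℂ}
    (hk : ∀ v, ∫ x, ⟪v, a x⟫_ℂ * ⟪b x, v⟫_ℂ ∂μ = k * ⟪v, v⟫_ℂ) (v w : H) :
    ∫ x, ⟪v, a x⟫_ℂ * ⟪b x, w⟫_ℂ ∂μ = k * ⟪v, w⟫_ℂ := by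
  have hi : ∀ v, Integrable (fun x => ⟪v, a x⟫_ℂ * ⟪b x, v⟫_ℂ) μ := fun v =>
    integrable_inner_mul_inner (ha v) (hb v)
  have hI := Complex.I_mul_I
  have h1 : ∀ x, ⟪v, a x⟫_ℂ * ⟪b x, w⟫_ℂ = (1 / 4 : ℂ) * ((⟪v + w, a x⟫_ℂ * ⟪b x, v + w⟫_ℂ
      - ⟪v - w, a x⟫_ℂ * ⟪b x, v - w⟫_ℂ)
      + (Complex.I * (⟪v - Complex.I • w, a x⟫_ℂ * ⟪b x, v - Complex.I • w⟫_ℂ)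
      - Complex.I * (⟪v + Complex.I • w, a x⟫_ℂ * ⟪b x, v + Complex.I • w⟫_ℂ))) := by
    intro x
    simp only [inner_add_left, inner_add_right, inner_sub_left, inner_sub_right, inner_smul_left,
      inner_smul_right, Complex.conj_I]
    linear_combination (1/2 * (⟪v, a x⟫_ℂ * ⟪b x, w⟫_ℂ) - 1/2 * (⟪w, a x⟫_ℂ * ⟪b x, v⟫_ℂ)) * hI
  rw [integral_congr_ae (.of_forall h1), integral_const_mul,
    integral_add (by exact (hi _).sub (hi _))
      (by exact ((hi _).const_mul _).sub ((hi _).const_mul _)),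
    integral_sub (hi _) (hi _), integral_sub ((hi _).const_mul _) ((hi _).const_mul _),
    integral_const_mul, integral_const_mul, hk, hk, hk, hk]
  simp only [inner_add_left, inner_add_right, inner_sub_left, inner_sub_right, inner_smul_left,
    inner_smul_right, Complex.conj_I]
  linear_combination k * (1/2 * ⟪w, v⟫_ℂ - 1/2 * ⟪v, w⟫_ℂ) * hI

end Polarization

/-! ### Orthogonality relations and formal degree -/

section FormalDegree

variable {G : Type*} [Group G]
variable {H : Type*} [NormedAddCommGroup H] [InnerProductSpace ℂ H] [CompleteSpace H]

theorem inner_repOp_repOp (π : G →* unitary (H →L[ℂ] H)) (g : G) (v w : H) :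
    ⟪repOp π g v, repOp π g w⟫_ℂ = ⟪v, w⟫_ℂ :=
  ContinuousLinearMap.inner_map_map_of_mem_unitary (π g).2 v w

theorem repOp_mul_apply (π : G →* unitary (H →L[ℂ] H)) (g h : G) (v : H) :
    repOp π (g * h) v = repOp π g (repOp π h v) := by
  simp only [repOp, map_mul, Submonoid.coe_mul, mul_apply_eq_comp]

theorem repOp_one_apply (π : G →* unitary (H →L[ℂ] H)) (v : H) : repOp π 1 v = v := by
  simp [repOp]

theorem inner_repOp_right (π : G →* unitary (H →L[ℂ] H)) (g : G) (v w : H) :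
    ⟪v, repOp π g w⟫_ℂ = ⟪repOp π g⁻¹ v, w⟫_ℂ := by
  rw [← inner_repOp_repOp π g (repOp π g⁻¹ v), ← repOp_mul_apply, mul_inv_cancel, repOp_one_apply]

variable [TopologicalSpace G] [IsTopologicalGroup G]
  [MeasurableSpace G] [BorelSpace G]

/-- The orthogonality relations of a square integrable representation, up to the positivity of the
constant. -/
theorem IsSquareIntegrableRep.exists_orthogonality {μ : Measure G} [μ.IsMulLeftInvariant]
    [μ.IsMulRightInvariant] {π : G →* unitary (H →L[ℂ] H)} (hsq : IsSquareIntegrableRep μ π)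
    (hcont : IsStronglyContinuousRep π) :
    (∀ φ ψ : H, MemLp (fun g => ⟪φ, repOp π g ψ⟫_ℂ) 2 μ) ∧
      ∃ k : ℂ, ∀ φ₁ ψ₁ φ₂ ψ₂ : H, ∫ g, ⟪φ₁, repOp π g ψ₁⟫_ℂ * ⟪repOp π g ψ₂, φ₂⟫_ℂ ∂μ =
        k * (⟪φ₁, φ₂⟫_ℂ * ⟪ψ₂, ψ₁⟫_ℂ) := by
  obtain ⟨hπ, φ₀, ψ₀, hφ₀, hψ₀, hmem⟩ := hsq
  have := hπ.1
  have hcoef : ∀ φ ψ : H, Continuous fun g => ⟪φ, repOp π g ψ⟫_ℂ := fun φ ψ =>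
    continuous_const.inner (hcont ψ)
  have hleft : ∀ ψ φ : H, φ ≠ 0 → MemLp (fun g => ⟪φ, repOp π g ψ⟫_ℂ) 2 μ →
      (∀ v, v ∈ l2Domain μ fun g => repOp π g ψ) ∧
        ∃ c : ℂ, ∀ v w, l2Form μ (fun g => repOp π g ψ) v w = c * ⟪v, w⟫_ℂ := by
    intro ψ φ hφ hm
    refine hπ.l2Form_eq (fun h => ⟨fun g => h⁻¹ * g, measurePreserving_mul_left μ h⁻¹,
      fun g v => ?_⟩) (fun v => ?_) hφ ?_
    · rw [inner_repOp_right, ← repOp_mul_apply]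
    · exact ((hcont ψ).inner continuous_const).stronglyMeasurable
    · rw [mem_l2Domain]
      simp_rw [← inner_conj_symm _ φ]
      exact hm.star
  have hright : ∀ φ ψ : H, ψ ≠ 0 → MemLp (fun g => ⟪φ, repOp π g ψ⟫_ℂ) 2 μ →
      (∀ v, v ∈ l2Domain μ fun g => repOp π g⁻¹ φ) ∧
        ∃ c : ℂ, ∀ v w, l2Form μ (fun g => repOp π g⁻¹ φ) v w = c * ⟪v, w⟫_ℂ := by
    intro φ ψ hψ hm
    -- Unimodularity enters here: the orbit `g ↦ π(g⁻¹)φ` is moved by right translations.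
    refine hπ.l2Form_eq (fun h => ⟨fun g => g * h, measurePreserving_mul_right μ h,
      fun g v => ?_⟩) (fun v => ?_) hψ ?_
    · rw [inner_repOp_right, ← repOp_mul_apply, mul_inv_rev]
    · simp_rw [← inner_repOp_right]
      exact (hcoef φ v).stronglyMeasurable
    · rw [mem_l2Domain]
      simpa only [← inner_repOp_right] using hm
  have hall : ∀ φ ψ : H, MemLp (fun g => ⟪φ, repOp π g ψ⟫_ℂ) 2 μ := by
    intro φ ψ
    -- Change one vector at a time: `(φ₀, ψ₀)`, then `(φ, ψ₀)`, then `(φ, ψ)`.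
    have h1 : MemLp (fun g => ⟪φ, repOp π g ψ₀⟫_ℂ) 2 μ := by
      simp_rw [← inner_conj_symm φ]
      exact (mem_l2Domain.mp ((hleft ψ₀ φ₀ hφ₀ hmem).1 φ)).star
    have h2 := mem_l2Domain.mp ((hright φ ψ₀ hψ₀ h1).1 ψ)
    simpa only [← inner_repOp_right] using h2
  have hc : ∀ ψ, ∃ c : ℂ, ∀ v w, l2Form μ (fun g => repOp π g ψ) v w = c * ⟪v, w⟫_ℂ := fun ψ =>
    (hleft ψ φ₀ hφ₀ (hall _ _)).2
  have hc' : ∀ φ, ∃ c : ℂ, ∀ v w, ∫ g, ⟪φ, repOp π g w⟫_ℂ * ⟪repOp π g v, φ⟫_ℂ ∂μ =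
      c * ⟪v, w⟫_ℂ := by
    intro φ
    obtain ⟨c, hc⟩ := (hright φ ψ₀ hψ₀ (hall _ _)).2
    refine ⟨c, fun v w => ?_⟩
    rw [← hc, l2Form]
    refine integral_congr_ae (.of_forall fun g => ?_)
    simp only
    rw [← inner_repOp_right, ← inner_conj_symm v, ← inner_repOp_right, inner_conj_symm, mul_comm]
  choose c hc using hc
  choose c' hc' using hc'
  simp only [l2Form] at hc
  obtain ⟨e, he⟩ := exists_norm_eq H zero_le_one
  have hee : ⟪e, e⟫_ℂ = 1 := by rw [inner_self_eq_norm_sq_to_K, he]; simp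
  -- `∫ |⟨φ, π(g)e⟩|²` is evaluated both as a form in `φ` and as a form in `e`.
  have hc'_eq : ∀ φ, c' φ = c e * ⟪φ, φ⟫_ℂ := fun φ => by
    rw [← hc, hc' φ e e, hee, mul_one]
  refine ⟨hall, c e, fun φ₁ ψ₁ φ₂ ψ₂ => ?_⟩
  rw [integral_inner_mul_inner_eq_of_diag (k := c e * ⟪ψ₂, ψ₁⟫_ℂ) (fun v => hall v ψ₁)
    (fun v => hall v ψ₂) (fun v => ?_)]
  · ring
  · rw [hc', hc'_eq]
    ring

/-- A square integrable representation of a unimodular group has a unique formal degree. -/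
theorem IsSquareIntegrableRep.existsUnique_isFormalDegree {μ : Measure G} [μ.IsHaarMeasure]
    [μ.IsMulRightInvariant] {π : G →* unitary (H →L[ℂ] H)} (hsq : IsSquareIntegrableRep μ π)
    (hcont : IsStronglyContinuousRep π) : ∃! d : ℝ, IsFormalDegree μ π d := by
  obtain ⟨hall, k, hk⟩ := hsq.exists_orthogonality hcont
  have := hsq.1.1
  obtain ⟨e, he⟩ := exists_norm_eq H zero_le_one
  have hee : ⟪e, e⟫_ℂ = 1 := by rw [inner_self_eq_norm_sq_to_K, he]; simp
  have hsqn : ∀ g, ⟪e, repOp π g e⟫_ℂ * ⟪repOp π g e, e⟫_ℂ =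
      ((‖⟪e, repOp π g e⟫_ℂ‖ ^ 2 : ℝ) : ℂ) := fun g => by
    rw [← inner_conj_symm _ e, Complex.mul_conj']
    norm_cast
  set r : ℝ := ∫ g, ‖⟪e, repOp π g e⟫_ℂ‖ ^ 2 ∂μ with hr
  have hkr : k = (r : ℂ) := by
    have := hk e e e e
    simp_rw [hsqn] at this
    rw [integral_complex_ofReal, hee, ← hr] at this
    rw [this]
    ring
  have hpos : 0 < r := by
    have hcts : Continuous fun g => ‖⟪e, repOp π g e⟫_ℂ‖ ^ 2 :=
      ((continuous_const.inner (hcont e)).norm).pow 2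
    refine (integral_pos_iff_support_of_nonneg (fun g => by positivity) ?_).mpr ?_
    · exact (memLp_two_iff_integrable_sq_norm (hall e e).1).mp (hall e e)
    -- The continuous integrand equals `1` at the identity, and Haar measure charges open sets.
    · refine hcts.isOpen_support.measure_pos μ ⟨1, ?_⟩
      simp [repOp_one_apply, he]
  refine ⟨r⁻¹, ⟨inv_pos.mpr hpos, hall, fun φ₁ ψ₁ φ₂ ψ₂ => ?_⟩, fun d hd => ?_⟩
  · rw [hk, hkr, Complex.ofReal_inv, inv_inv]
  · have h1 := hd.2.2 e e e e
    rw [hk, hee, hkr, mul_one, mul_one, mul_one] at h1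
    rw [← inv_inj, inv_inv]
    exact_mod_cast h1.symm

end FormalDegree

/-! ### Parseval sums -/

section Parseval

variable {H : Type*} [NormedAddCommGroup H] [InnerProductSpace ℂ H]

theorem HilbertBasis.hasSum_norm_inner_sq {ι : Type*} (f : HilbertBasis ι ℂ H) (v : H) :
    HasSum (fun j => ‖⟪f j, v⟫_ℂ‖ ^ 2) (‖v‖ ^ 2) := by
  have h := Complex.hasSum_re (f.hasSum_inner_mul_inner v v)
  rw [show (⟪v, v⟫_ℂ).re = ‖v‖ ^ 2 from inner_self_eq_norm_sq (𝕜 := ℂ) v] at h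
  refine h.congr_fun fun j => ?_
  rw [← inner_conj_symm v, Complex.conj_mul']
  norm_cast

theorem Summable.norm_inner_sq_prod {ι κ : Type*} (f : HilbertBasis κ ℂ H) {x : ι → H}
    (hx : Summable fun i => ‖x i‖ ^ 2) : Summable fun p : ι × κ => ‖⟪f p.2, x p.1⟫_ℂ‖ ^ 2 := by
  rw [summable_prod_of_nonneg fun p => by positivity]
  refine ⟨fun i => (f.hasSum_norm_inner_sq (x i)).summable, hx.congr fun i => ?_⟩
  exact ((f.hasSum_norm_inner_sq (x i)).tsum_eq).symm

end Parseval

/-! ### Hilbert-Schmidt factorization and basis independence of the trace -/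

section TraceClass

variable {H : Type*} [NormedAddCommGroup H] [InnerProductSpace ℂ H] [CompleteSpace H]

/-- If `‖A v‖ = ‖T (T v)‖` with `T` self-adjoint, then `A` factors as `Y * T` with
`‖Y u‖ ≤ ‖T u‖`. -/
theorem exists_eq_mul_of_norm_eq {A T : H →L[ℂ] H} (hT : IsSelfAdjoint T)
    (h : ∀ v, ‖A v‖ = ‖T (T v)‖) : ∃ Y : H →L[ℂ] H, A = Y * T ∧ ∀ u, ‖Y u‖ ≤ ‖T u‖ := by
  let K : Submodule ℂ H := T.range.topologicalClosure
  have hK : IsClosed (K : Set H) := Submodule.isClosed_topologicalClosure _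
  have : CompleteSpace K := hK.completeSpace_coe
  have hTK : ∀ v, T v ∈ K := fun v => Submodule.le_topologicalClosure _ ⟨v, rfl⟩
  let e : H →ₗ[ℂ] K := T.toLinearMap.codRestrict K hTK
  have he : ∀ v, (e v : H) = T v := fun v => rfl
  have hdense : DenseRange e := by
    intro x
    rw [closure_subtype]
    refine closure_mono ?_ x.2
    rintro _ ⟨v, rfl⟩
    exact ⟨e v, ⟨v, rfl⟩, rfl⟩
  have hbound : ∀ v, ‖A v‖ ≤ ‖T‖ * ‖e v‖ := fun v => by
    rw [h]
    exact T.le_opNorm _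
  -- `Y₀` extends `T v ↦ A v` to the closure of the range of `T`; on the orthogonal complement,
  -- where `T` vanishes, `Y` will be zero.
  let Y₀ : K →L[ℂ] H := A.toLinearMap.extendOfNorm e
  have hY₀ : ∀ v, Y₀ (e v) = A v := LinearMap.extendOfNorm_eq hdense ⟨_, hbound⟩
  have hY₀T : ∀ x : K, ‖Y₀ x‖ = ‖T x‖ := by
    refine fun x => hdense.induction_on x (isClosed_eq (by fun_prop) (by fun_prop)) fun v => ?_
    rw [hY₀, he, h]
  have hproj : ∀ u, T (K.orthogonalProjectionOnto u : H) = T u := by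
    intro u
    have h1 : u - K.starProjection u ∈ Kᗮ := K.sub_starProjection_mem_orthogonal u
    rw [eq_comm, ← sub_eq_zero, ← map_sub]
    refine ext_inner_left ℂ fun w => ?_
    rw [inner_zero_right, ← ContinuousLinearMap.adjoint_inner_left,
      (ContinuousLinearMap.isSelfAdjoint_iff'.mp hT)]
    exact (Submodule.mem_orthogonal _ _).mp h1 _ (hTK w)
  refine ⟨Y₀ ∘L K.orthogonalProjectionOnto, ?_, fun u => ?_⟩
  · ext v
    change A v = Y₀ (K.orthogonalProjectionOnto (T v))
    rw [← hY₀, ← he, Submodule.orthogonalProjectionOnto_mem_subspace_eq_self]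
  · change ‖Y₀ (K.orthogonalProjectionOnto u)‖ ≤ _
    rw [hY₀T, hproj]

/-- A trace-class operator is a product of two Hilbert-Schmidt operators, one of them
self-adjoint. -/
theorem IsTraceClass.exists_eq_mul {A : H →L[ℂ] H} (hA : IsTraceClass A) :
    ∃ (w : Set H) (e : HilbertBasis w ℂ H) (Y T : H →L[ℂ] H), A = Y * T ∧ IsSelfAdjoint T ∧
      (Summable fun i => ‖Y (e i)‖ ^ 2) ∧ Summable fun i => ‖T (e i)‖ ^ 2 := by
  obtain ⟨w, e, he⟩ := hA
  let T : H →L[ℂ] H := CFC.sqrt (CFC.abs A)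
  have hT : IsSelfAdjoint T := (CFC.sqrt_nonneg (CFC.abs A)).isSelfAdjoint
  have hTT : T * T = CFC.abs A := CFC.sqrt_mul_sqrt_self _ (CFC.abs_nonneg A)
  have hsymm : ∀ v w, ⟪T v, w⟫_ℂ = ⟪v, T w⟫_ℂ := fun v w => by
    rw [← ContinuousLinearMap.adjoint_inner_right, ContinuousLinearMap.isSelfAdjoint_iff'.mp hT]
  have hnorm : ∀ v, ‖A v‖ = ‖T (T v)‖ := by
    intro v
    have h1 : (star A * A) v = T (T (T (T v))) := by
      rw [← CFC.abs_mul_abs, ← hTT]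
      rfl
    have h2 : ⟪A v, A v⟫_ℂ = ⟪T (T v), T (T v)⟫_ℂ := by
      rw [hsymm, hsymm, ← h1]
      exact (ContinuousLinearMap.adjoint_inner_right A v (A v)).symm
    rw [inner_self_eq_norm_sq_to_K, inner_self_eq_norm_sq_to_K] at h2
    have h3 : ‖A v‖ ^ 2 = ‖T (T v)‖ ^ 2 := by exact_mod_cast h2
    exact (sq_eq_sq₀ (norm_nonneg _) (norm_nonneg _)).mp h3
  obtain ⟨Y, hY, hYT⟩ := exists_eq_mul_of_norm_eq hT hnorm
  have hsum : Summable fun i => ‖T (e i)‖ ^ 2 := by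
    refine he.congr fun i => ?_
    rw [← hTT]
    change (⟪e i, T (T (e i))⟫_ℂ).re = _
    rw [← hsymm]
    exact inner_self_eq_norm_sq (𝕜 := ℂ) _
  refine ⟨w, e, Y, T, hY, hT, hsum.of_nonneg_of_le (fun i => by positivity) fun i => ?_, hsum⟩
  gcongr
  exact hYT _

/-- The Hilbert-Schmidt inner product of `S` and `R` is the trace of `R S†` in any orthonormal
basis. -/
theorem hasSum_inner_adjoint_of_summable {ι κ : Type*} (e : HilbertBasis ι ℂ H)
    (f : HilbertBasis κ ℂ H) {S R : H →L[ℂ] H} (hS : Summable fun i => ‖S (e i)‖ ^ 2)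
    (hR : Summable fun i => ‖R (e i)‖ ^ 2) :
    HasSum (fun j => ⟪star R (f j), star S (f j)⟫_ℂ) (∑' i, ⟪S (e i), R (e i)⟫_ℂ) := by
  -- Parseval in `f` sums the rows, Parseval in `e` the columns; `ab ≤ a² + b²` gives the
  -- summability that permits the exchange.
  let F : ι × κ → ℂ := fun p => ⟪S (e p.1), f p.2⟫_ℂ * ⟪f p.2, R (e p.1)⟫_ℂ
  have hF : Summable F := by
    refine Summable.of_norm_bounded
      ((hS.norm_inner_sq_prod f).add (hR.norm_inner_sq_prod f)) fun p => ?_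
    rw [norm_mul, norm_inner_symm]
    nlinarith [sq_nonneg (‖⟪f p.2, S (e p.1)⟫_ℂ‖ - ‖⟪f p.2, R (e p.1)⟫_ℂ‖),
      sq_nonneg (‖⟪f p.2, S (e p.1)⟫_ℂ‖ + ‖⟪f p.2, R (e p.1)⟫_ℂ‖)]
  have h1 : HasSum F (∑' i, ⟪S (e i), R (e i)⟫_ℂ) := by
    have := hF.hasSum
    rwa [← (this.prod_fiberwise fun i => f.hasSum_inner_mul_inner (S (e i)) (R (e i))).tsum_eq]
      at this
  refine ((Equiv.prodComm κ ι).hasSum_iff.mpr h1).prod_fiberwise fun j => ?_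
  refine (e.hasSum_inner_mul_inner (star R (f j)) (star S (f j))).congr_fun fun i => ?_
  change ⟪S (e i), f j⟫_ℂ * ⟪f j, R (e i)⟫_ℂ = _
  rw [ContinuousLinearMap.star_eq_adjoint, ContinuousLinearMap.star_eq_adjoint,
    ContinuousLinearMap.adjoint_inner_left, ContinuousLinearMap.adjoint_inner_right, mul_comm]

end TraceClass

/-! ### Termwise integration and the trace formula -/

section Averaging

/-- Countability makes the finite partial sums a countably generated limit, so `f` is a.e. strongly
measurable; `∑ ‖Fᵢ‖` dominates it. -/
theorem integrable_and_hasSum_integral {X ι : Type*} [MeasurableSpace X] {μ : Measure X}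
    [Countable ι] {F : ι → X → ℂ} {f : X → ℂ} (hF : ∀ i, Integrable (F i) μ)
    (hsum : Summable fun i => ∫ x, ‖F i x‖ ∂μ) (hf : ∀ x, HasSum (F · x) (f x)) :
    Integrable f μ ∧ HasSum (fun i => ∫ x, F i x ∂μ) (∫ x, f x ∂μ) := by
  have hfe : f = fun x => ∑' i, F i x := funext fun x => (hf x).tsum_eq.symm
  refine ⟨⟨?_, ?_⟩, ?_⟩
  · have : ∀ᵐ x ∂μ, HasSum (F · x) (f x) := .of_forall hf
    exact aestronglyMeasurable_of_tendsto_ae (u := (Filter.atTop : Filter (Finset ι)))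
      (f := fun s x => ∑ i ∈ s, F i x)
      (fun s => (integrable_finsetSum s fun i _ => hF i).1) this
  · have hle : ∀ x, ‖f x‖ₑ ≤ ∑' i, ‖F i x‖ₑ := fun x => by
      rw [hfe]
      exact enorm_tsum_le_tsum_enorm
    refine (lintegral_mono hle).trans_lt ?_
    rw [lintegral_tsum fun i => (hF i).1.enorm]
    have : ∀ i, ∫⁻ x, ‖F i x‖ₑ ∂μ = ENNReal.ofReal (∫ x, ‖F i x‖ ∂μ) := fun i =>
      (ofReal_integral_norm_eq_lintegral_enorm (hF i)).symm
    simp_rw [this]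
    rw [← ENNReal.ofReal_tsum_of_nonneg (fun i => integral_nonneg fun x => norm_nonneg _) hsum]
    exact ENNReal.ofReal_lt_top
  · rw [hfe]
    exact hasSum_integral_of_summable_integral_norm hF hsum

variable {G : Type*} [Group G] [MeasurableSpace G]
variable {H : Type*} [NormedAddCommGroup H] [InnerProductSpace ℂ H] [CompleteSpace H]

theorem IsFormalDegree.integral_norm_sq {μ : Measure G} {π : G →* unitary (H →L[ℂ] H)} {d : ℝ}
    (hd : IsFormalDegree μ π d) (φ ψ : H) :
    ∫ g, ‖⟪φ, repOp π g ψ⟫_ℂ‖ ^ 2 ∂μ = d⁻¹ * (‖φ‖ ^ 2 * ‖ψ‖ ^ 2) := by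
  have h := hd.2.2 φ ψ φ ψ
  have hsqn : ∀ g, ⟪φ, repOp π g ψ⟫_ℂ * ⟪repOp π g ψ, φ⟫_ℂ =
      ((‖⟪φ, repOp π g ψ⟫_ℂ‖ ^ 2 : ℝ) : ℂ) := fun g => by
    rw [← inner_conj_symm _ φ, Complex.mul_conj']
    norm_cast
  simp_rw [hsqn] at h
  rw [integral_complex_ofReal, inner_self_eq_norm_sq_to_K, inner_self_eq_norm_sq_to_K] at h
  exact Complex.ofReal_injective (by push_cast; exact h)

theorem IsFormalDegree.integral_norm_mul_le {μ : Measure G} {π : G →* unitary (H →L[ℂ] H)} {d : ℝ}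
    (hd : IsFormalDegree μ π d) (φ ψ x y : H) :
    ∫ g, ‖⟪φ, repOp π g x⟫_ℂ * ⟪repOp π g y, ψ⟫_ℂ‖ ∂μ ≤
      d⁻¹ * (‖φ‖ ^ 2 * ‖x‖ ^ 2) + d⁻¹ * (‖ψ‖ ^ 2 * ‖y‖ ^ 2) := by
  have hint : ∀ φ ψ : H, Integrable (fun g => ‖⟪φ, repOp π g ψ⟫_ℂ‖ ^ 2) μ := fun φ ψ =>
    (memLp_two_iff_integrable_sq_norm (hd.2.1 φ ψ).1).mp (hd.2.1 φ ψ)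
  rw [← hd.integral_norm_sq, ← hd.integral_norm_sq, ← integral_add (hint _ _) (hint _ _)]
  refine integral_mono (integrable_inner_mul_inner (hd.2.1 _ _) (hd.2.1 _ _)).norm
    ((hint _ _).add (hint _ _)) fun g => ?_
  simp only
  rw [norm_mul, norm_inner_symm _ ψ]
  nlinarith [sq_nonneg (‖⟪φ, repOp π g x⟫_ℂ‖ - ‖⟪ψ, repOp π g y⟫_ℂ‖),
      sq_nonneg (‖⟪φ, repOp π g x⟫_ℂ‖ + ‖⟪ψ, repOp π g y⟫_ℂ‖)]

theorem IsFormalDegree.hasWeakIntegral_mul {μ : Measure G} {π : G →* unitary (H →L[ℂ] H)} {d : ℝ}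
    (hd : IsFormalDegree μ π d) {ι : Type*} (e : HilbertBasis ι ℂ H) {Y T : H →L[ℂ] H}
    (hT : IsSelfAdjoint T) (hYs : Summable fun i => ‖Y (e i)‖ ^ 2)
    (hTs : Summable fun i => ‖T (e i)‖ ^ 2) :
    HasWeakIntegral μ (fun g => repOp π g * (Y * T) * star (repOp π g))
      (((d : ℂ)⁻¹ * ∑' i, ⟪T (e i), Y (e i)⟫_ℂ) • (1 : H →L[ℂ] H)) := by
  intro φ ψ
  -- The basis may be uncountable, but only countably many `T eᵢ` are nonzero; termwise integration
  -- needs a countable index.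
  let s : Set ι := Function.support fun i => ‖T (e i)‖ ^ 2
  have : Countable s := hTs.countable_support.to_subtype
  have hs : ∀ i ∉ s, T (e i) = 0 := fun i hi => by simpa [s] using hi
  let F : ι → G → ℂ := fun i g => ⟪φ, repOp π g (Y (e i))⟫_ℂ * ⟪repOp π g (T (e i)), ψ⟫_ℂ
  have hF : ∀ g, HasSum (fun i => F i g)
      ⟪φ, (repOp π g * (Y * T) * star (repOp π g)) ψ⟫_ℂ := by
    intro g
    let V := repOp π g
    have h1 : ⟪φ, (V * (Y * T) * star V) ψ⟫_ℂ = ⟪star Y (star V φ), T (star V ψ)⟫_ℂ := by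
      change ⟪φ, V (Y (T (star V ψ)))⟫_ℂ = _
      simp only [ContinuousLinearMap.star_eq_adjoint, ContinuousLinearMap.adjoint_inner_left]
    rw [h1]
    refine (e.hasSum_inner_mul_inner _ _).congr_fun fun i => ?_
    change ⟪φ, V (Y (e i))⟫_ℂ * ⟪V (T (e i)), ψ⟫_ℂ = _
    conv_rhs => rw [← ContinuousLinearMap.adjoint_inner_left T,
      ContinuousLinearMap.isSelfAdjoint_iff'.mp hT]
    simp only [ContinuousLinearMap.star_eq_adjoint, ContinuousLinearMap.adjoint_inner_left,
      ContinuousLinearMap.adjoint_inner_right]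
  have hF' : ∀ g, HasSum (fun i : s => F i g)
      ⟪φ, (repOp π g * (Y * T) * star (repOp π g)) ψ⟫_ℂ := fun g =>
    (hasSum_subtype_iff_of_support_subset fun i hi => by
      by_contra h
      exact hi (by simp [F, hs i h])).mpr (hF g)
  have hsum : Summable fun i : s => ∫ g, ‖F i g‖ ∂μ := by
    refine Summable.of_nonneg_of_le (fun i => integral_nonneg fun g => norm_nonneg _)
      (fun i => hd.integral_norm_mul_le φ ψ _ _) ?_
    exact (((hYs.mul_left _).mul_left _).add ((hTs.mul_left _).mul_left _)).subtype s
  obtain ⟨h1, h2⟩ := integrable_and_hasSum_integral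
    (fun i : s => integrable_inner_mul_inner (hd.2.1 φ (Y (e i))) (hd.2.1 ψ (T (e i)))) hsum hF'
  refine ⟨h1, ?_⟩
  rw [← h2.tsum_eq]
  simp only [hd.2.2]
  rw [tsum_mul_left, tsum_mul_left, tsum_subtype_eq_of_support_subset
    (f := fun i => ⟪T (e i), Y (e i)⟫_ℂ), smul_apply, one_apply_eq_self, inner_smul_right]
  · ring
  · intro i hi
    by_contra h
    exact hi (by simp [hs i h])

/-- The trace formula for the average of a trace-class operator over a representation with a formal
degree. -/
theorem IsFormalDegree.hasWeakIntegral {μ : Measure G} {π : G →* unitary (H →L[ℂ] H)} {d : ℝ}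
    (hd : IsFormalDegree μ π d) {A : H →L[ℂ] H} (hA : IsTraceClass A) :
    (∀ (w : Set H) (e : HilbertBasis w ℂ H), HasSum (fun i : w => ⟪e i, A (e i)⟫_ℂ) (opTrace A)) ∧
      HasWeakIntegral μ (fun g => repOp π g * A * star (repOp π g))
        (((d : ℂ)⁻¹ * opTrace A) • (1 : H →L[ℂ] H)) := by
  obtain ⟨w, e, Y, T, rfl, hT, hYs, hTs⟩ := hA.exists_eq_mul
  have htr : ∀ (w' : Set H) (f : HilbertBasis w' ℂ H),
      HasSum (fun i : w' => ⟪f i, (Y * T) (f i)⟫_ℂ) (∑' i, ⟪T (e i), Y (e i)⟫_ℂ) := by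
    intro w' f
    refine (hasSum_inner_adjoint_of_summable e f hTs hYs).congr_fun fun j => ?_
    rw [hT.star_eq, ContinuousLinearMap.star_eq_adjoint, ContinuousLinearMap.adjoint_inner_left]
    rfl
  have hop : opTrace (Y * T) = ∑' i, ⟪T (e i), Y (e i)⟫_ℂ := (htr _ (someBasis H)).tsum_eq
  rw [hop]
  exact ⟨htr, hd.hasWeakIntegral_mul e hT hYs hTs⟩

end Averaging

end

theorem mainTheorem8
    {E : Type*} [NormedAddCommGroup E] [NormedSpace ℝ E] [FiniteDimensional ℝ E]
    {G : Type*} [Group G] [TopologicalSpace G] [T2Space G] [SecondCountableTopology G]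
    [ChartedSpace E G] [LieGroup 𝓘(ℝ, E) ∞ G]
    [MeasurableSpace G] [BorelSpace G]
    (μ : Measure G) [μ.IsHaarMeasure] [μ.IsMulRightInvariant]
    {𝒜 : Type*} [CStarAlgebra 𝒜] [PartialOrder 𝒜] [StarOrderedRing 𝒜]
    (ρ₀ : 𝒜 →ₚ[ℂ] ℂ) (hρ₀ : ρ₀ 1 = 1)
    (U : G →* unitary 𝒜)
    (hcont : IsStronglyContinuousRep (gnsRep ρ₀ U))
    (hsq : IsSquareIntegrableRep μ (gnsRep ρ₀ U)) :
    (∃! d : ℝ, IsFormalDegree μ (gnsRep ρ₀ U) d) ∧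
    ∀ d : ℝ, IsFormalDegree μ (gnsRep ρ₀ U) d →
      ∀ A : ρ₀.GNS →L[ℂ] ρ₀.GNS, IsTraceClass A →
        (∀ (w : Set ρ₀.GNS) (e : HilbertBasis w ℂ ρ₀.GNS),
          HasSum (fun i : w => ⟪e i, A (e i)⟫_ℂ) (opTrace A)) ∧
        ∃ C : ρ₀.GNS →L[ℂ] ρ₀.GNS,
          HasWeakIntegral μ
            (fun g => repOp (gnsRep ρ₀ U) g * A * star (repOp (gnsRep ρ₀ U) g)) C ∧
          opTrace A • (1 : ρ₀.GNS →L[ℂ] ρ₀.GNS) = (d : ℂ) • C := by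
  have : IsTopologicalGroup G := topologicalGroup_of_lieGroup 𝓘(ℝ, E) ∞
  refine ⟨hsq.existsUnique_isFormalDegree hcont, fun d hd A hA => ?_⟩
  obtain ⟨htr, hint⟩ := hd.hasWeakIntegral hA
  refine ⟨htr, _, hint, ?_⟩
  have hd0 : (d : ℂ) ≠ 0 := Complex.ofReal_ne_zero.mpr hd.1.ne'
  rw [smul_smul, mul_inv_cancel_left₀ hd0]
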